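/- For a finite abelian group $G$ (written additively), a subset $A \subseteq G$ and a positive integer $h$, let $h\hat{\;}A$ denote the set of all sums of $h$ distinct elements of $A$. Let $\hat{\chi}(G,h)$ denote the restricted $h$-critical number of $G$, i.e. the smallest integer $m \leq |G|$, if one exists, such that $h\hat{\;}A = G$ for every $A \subseteq G$ with $|A| \geq m$. If $n \geq 1235$ is an odd integer, then $\hat{\chi}(\mathbb{Z}_n,3)$ exists and $$\hat{\chi}(\mathbb{Z}_n,3) \leq \tfrac{2}{5}n + 1.$$ -/

import Mathlib

/-- The `h`-fold restricted sumset of a finite set `A`: all sums of `h` distinct elements of `A`. -/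
def restrictedSumset {G : Type*} [AddCommGroup G] (h : ℕ) (A : Finset G) : Set G :=
  {x | ∃ B : Finset G, B ⊆ A ∧ B.card = h ∧ ∑ b ∈ B, b = x}

/-- The sizes `m ≤ |G|` such that every subset of `G` with at least `m` elements has
`h`-fold restricted sumset equal to `G`. The bound `m ≤ |G|` excludes the sizes for which
the condition is vacuous, so the critical number is well defined iff this set is nonempty. -/
def restrictedCriticalSizes (G : Type*) [AddCommGroup G] (h : ℕ) : Set ℕ :=
  {m | m ≤ Nat.card G ∧ ∀ A : Finset G, m ≤ A.card → restrictedSumset h A = Set.univ}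

/-- The restricted `h`-critical number of a finite abelian group `G`, meaningful when
`restrictedCriticalSizes G h` is nonempty. -/
noncomputable def restrictedCriticalNumber (G : Type*) [AddCommGroup G] (h : ℕ) : ℕ :=
  sInf (restrictedCriticalSizes G h)

open Finset Pointwise

/-! Suppose `g` is missed, with `n = |G|` and `r = sumRep A`. Then `r ≤ 3` on `g - A`, so averaging
off `g - A` gives `s` with `r s` about `4n/15` or more. Differences of `A` have small `shiftDefect`,
so `r > 3` on `s + (A - A)`, which therefore avoids `g - A`. Hence `#(A - A) ≤ n - #A < 3/2 * #A`,
making `A - A` a subgroup; odd index below `5/2` forces `A - A = G`, a contradiction. -/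

/-- The number of representations of `x` as an ordered sum of two elements of `A`. -/
def sumRep {G : Type*} [AddCommGroup G] [DecidableEq G] (A : Finset G) (x : G) : ℕ :=
  #{u ∈ A | x - u ∈ A}

/-- The number of elements of `A` that translation by `d` moves out of `A`. -/
def shiftDefect {G : Type*} [AddCommGroup G] [DecidableEq G] (A : Finset G) (d : G) : ℕ :=
  #{u ∈ A | u + d ∉ A}

section

variable {G : Type*} [AddCommGroup G] [DecidableEq G]

theorem sum_sumRep [Fintype G] (A : Finset G) : ∑ x, sumRep A x = #A * #A := by
  have h : ∀ x, sumRep A x = ∑ u ∈ A, if x - u ∈ A then 1 else 0 := fun x => by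
    rw [sumRep, card_filter]
  simp_rw [h]
  rw [sum_comm, sum_const_nat]
  intro u _
  rw [← Equiv.sum_comp (Equiv.addRight u)]
  simp

theorem sumRep_le_add_shiftDefect (A : Finset G) (s d : G) :
    sumRep A s ≤ sumRep A (s + d) + shiftDefect A d := by
  have h₁ : ({u ∈ A | s - u ∈ A} : Finset G) ⊆
      {u ∈ A | s + d - u ∈ A} ∪ ({u ∈ A | u + d ∉ A} : Finset G).image (s - ·) := by
    intro u hu
    obtain ⟨hu, hsu⟩ := mem_filter.1 hu
    by_cases h : s + d - u ∈ A
    · exact mem_union_left _ (mem_filter.2 ⟨hu, h⟩)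
    · refine mem_union_right _ (mem_image.2 ⟨s - u, mem_filter.2 ⟨hsu, ?_⟩, by abel⟩)
      rwa [sub_add_eq_add_sub]
  exact (card_le_card h₁).trans ((card_union_le _ _).trans (Nat.add_le_add_left card_image_le _))

theorem shiftDefect_add_le (A : Finset G) (d e : G) :
    shiftDefect A (d + e) ≤ shiftDefect A d + shiftDefect A e := by
  have h₁ : ({u ∈ A | u + (d + e) ∉ A} : Finset G) ⊆
      {u ∈ A | u + d ∉ A} ∪ ({u ∈ A | u + e ∉ A} : Finset G).image (· - d) := by
    intro u hu
    obtain ⟨hu, hsu⟩ := mem_filter.1 hu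
    by_cases h : u + d ∈ A
    · refine mem_union_right _ (mem_image.2 ⟨u + d, mem_filter.2 ⟨h, ?_⟩, by abel⟩)
      rwa [add_assoc]
    · exact mem_union_left _ (mem_filter.2 ⟨hu, h⟩)
  exact (card_le_card h₁).trans ((card_union_le _ _).trans (Nat.add_le_add_left card_image_le _))

theorem mem_sub_of_shiftDefect_lt {A : Finset G} {d : G} (h : shiftDefect A d < #A) :
    d ∈ A - A := by
  by_contra hd
  refine h.ne (congrArg card (filter_true_of_mem fun u hu hud => hd ?_))
  exact mem_sub.2 ⟨u + d, hud, u, hu, by abel⟩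

theorem shiftDefect_add_card_le (A : Finset G) (x y : G) :
    shiftDefect A (y - x) + #A ≤ #(A.image (x - ·) ∪ A.image (y - ·)) := by
  have h₁ : shiftDefect A (y - x) = #(({u ∈ A | u + (y - x) ∉ A} : Finset G).image (x - ·)) :=
    (card_image_of_injective _ sub_right_injective).symm
  have h₂ : #A = #(A.image (y - ·)) := (card_image_of_injective _ sub_right_injective).symm
  rw [h₁, h₂, ← card_union_of_disjoint]
  · exact card_le_card (union_subset_union_left (image_subset_image (filter_subset _ _)))
  · rw [disjoint_left]
    intro w hw hw'
    obtain ⟨u, hu, rfl⟩ := mem_image.1 hw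
    obtain ⟨v, hv, hvu⟩ := mem_image.1 hw'
    refine (mem_filter.1 hu).2 ?_
    have : u + (y - x) = v := by
      have : v = y - (x - u) := by rw [← hvu]; abel
      rw [this]; abel
    rwa [this]

/-- A difference set with fewer than `3/2 * #A` elements is closed under addition. -/
theorem add_mem_sub_of_card_lt {A : Finset G} (hA : 2 * #(A - A) < 3 * #A) {d e : G}
    (hd : d ∈ A - A) (he : e ∈ A - A) : d + e ∈ A - A := by
  -- Two defects below `#A / 2` add up to less than `#A`, so some translate by `d + e` stays in `A`.
  have key : ∀ d ∈ A - A, 2 * shiftDefect A d < #A := by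
    intro d hd
    obtain ⟨y, hy, x, hx, rfl⟩ := mem_sub.1 hd
    have hle := shiftDefect_add_card_le A x y
    have hsub : A.image (x - ·) ∪ A.image (y - ·) ⊆ A - A :=
      union_subset (image_subset_iff.2 fun u hu => sub_mem_sub hx hu)
        (image_subset_iff.2 fun u hu => sub_mem_sub hy hu)
    have := card_le_card hsub
    omega
  refine mem_sub_of_shiftDefect_lt ?_
  have := shiftDefect_add_le A d e
  have := key d hd
  have := key e he
  omega

/-- In a group of odd order, a set of density more than `2/5` cannot have a difference set
with fewer than `3/2 * #A` elements unless that difference set is the whole group. -/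
theorem card_sub_eq_of_card_lt [Fintype G] (hodd : Odd (Fintype.card G)) {A : Finset G}
    (hA : 2 * Fintype.card G < 5 * #A) (hD : 2 * #(A - A) < 3 * #A) :
    #(A - A) = Fintype.card G := by
  have hne : A.Nonempty := card_pos.1 (by omega)
  have hneg : ∀ d ∈ A - A, -d ∈ A - A := by
    intro d hd
    obtain ⟨y, hy, x, hx, rfl⟩ := mem_sub.1 hd
    exact mem_sub.2 ⟨x, hx, y, hy, by abel⟩
  let H : AddSubgroup G :=
    { carrier := (A - A : Finset G)
      add_mem' := fun hd he => by
        rw [mem_coe] at *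
        exact add_mem_sub_of_card_lt hD hd he
      zero_mem' := by
        obtain ⟨x, hx⟩ := hne
        exact mem_coe.2 (mem_sub.2 ⟨x, hx, x, hx, sub_self x⟩)
      neg_mem' := fun {d} hd => mem_coe.2 (hneg d (mem_coe.1 hd)) }
  have hcard : Nat.card H = #(A - A) := by
    change Nat.card ((A - A : Finset G) : Set G) = _
    rw [Nat.card_coe_set_eq, Set.ncard_coe_finset]
  have hdvd : #(A - A) ∣ Fintype.card G := by
    rw [← hcard, ← Nat.card_eq_fintype_card]
    exact H.card_addSubgroup_dvd_card
  obtain ⟨k, hk⟩ := hdvd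
  have hle : #A ≤ #(A - A) := card_le_card_sub_right hne
  have hkodd : Odd k := by
    rw [hk] at hodd
    exact (Nat.odd_mul.1 hodd).2
  have hk3 : k < 3 := by
    by_contra! h
    have := Nat.mul_le_mul_left #(A - A) h
    omega
  obtain ⟨j, rfl⟩ := hkodd
  obtain rfl : j = 0 := by omega
  omega

variable [Fintype G]

theorem sumRep_le_three (hodd : Odd (Fintype.card G)) {A : Finset G} {g z : G} (hz : z ∈ A)
    (hg : g ∉ restrictedSumset 3 A) : sumRep A (g - z) ≤ 3 := by
  have hinj : Function.Injective fun u : G => 2 • u := by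
    have : (Nat.card G).Coprime 2 := by
      rw [Nat.card_eq_fintype_card]
      exact Nat.coprime_two_right.2 hodd
    exact (nsmulCoprime this).injective
  -- Only coincidences among `z`, `u`, `g - z - u` are allowed; odd order makes halving unique.
  have hsub : ({u ∈ A | g - z - u ∈ A} : Finset G) ⊆
      {z, g - z - z} ∪ ({u | 2 • u = g - z} : Finset G) := by
    intro u hu
    obtain ⟨hu, hv⟩ := mem_filter.1 hu
    by_contra hn
    simp only [mem_union, mem_insert, mem_singleton, mem_filter, mem_univ, true_and,
      not_or] at hn
    obtain ⟨⟨h₁, h₂⟩, h₃⟩ := hn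
    have huv : u ≠ g - z - u := fun h => h₃ (by
      rw [two_nsmul]
      exact eq_sub_iff_add_eq.1 h)
    have hzv : z ≠ g - z - u := fun h => h₂ (by
      rw [eq_sub_iff_add_eq] at h ⊢
      rw [add_comm]
      exact h)
    refine hg ⟨{z, u, g - z - u}, ?_, card_eq_three.2 ⟨z, u, _, Ne.symm h₁, hzv, huv, rfl⟩, ?_⟩
    · simp [insert_subset_iff, hz, hu, hv]
    · rw [sum_insert (by simp [Ne.symm h₁, hzv]), sum_insert (by simpa using huv), sum_singleton]
      abel
  have h₁ : #({u | 2 • u = g - z} : Finset G) ≤ 1 := by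
    refine card_le_one.2 fun u hu v hv => hinj ?_
    simp only [mem_filter, mem_univ, true_and] at hu hv
    simp [hu, hv]
  have h₂ : #({z, g - z - z} : Finset G) ≤ 2 := card_le_two
  have := (card_le_card hsub).trans (card_union_le _ _)
  rw [sumRep]
  omega

/-- If `g` is not a sum of three distinct elements of `A`, then every difference of two elements
of `A` is popular. -/
theorem shiftDefect_le_of_notMem (hodd : Odd (Fintype.card G)) {A : Finset G} {g d : G}
    (hg : g ∉ restrictedSumset 3 A) (hd : d ∈ A - A) :
    shiftDefect A d + 2 * #A ≤ Fintype.card G + 6 := by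
  obtain ⟨z, hz, z', hz', rfl⟩ := mem_sub.1 hd
  have hle := shiftDefect_add_card_le A (g - z) (g - z')
  rw [sub_sub_sub_cancel_left] at hle
  have hI : ∀ w ∈ A, #(A.image (g - w - ·) ∩ A) ≤ 3 := by
    intro w hw
    refine le_trans (card_le_card ?_) (sumRep_le_three hodd hw hg)
    intro v hv
    obtain ⟨hv, hvA⟩ := mem_inter.1 hv
    obtain ⟨u, hu, rfl⟩ := mem_image.1 hv
    exact mem_filter.2 ⟨hvA, by rwa [sub_sub_cancel]⟩
  -- Both reflected copies of `A` lie in `Aᶜ` up to 3 points each.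
  have hsub : A.image (g - z - ·) ∪ A.image (g - z' - ·) ⊆
      Aᶜ ∪ (A.image (g - z - ·) ∩ A ∪ A.image (g - z' - ·) ∩ A) := by
    intro v hv
    by_cases h : v ∈ A
    · simpa [h] using hv
    · simp [h]
  have h₁ := (card_le_card hsub).trans ((card_union_le _ _).trans
    (Nat.add_le_add_left (card_union_le _ _) _))
  have h₂ := hI z hz
  have h₃ := hI z' hz'
  have h₄ := card_add_card_compl A
  omega

/-- If `g` is not a sum of three distinct elements of `A`, then some element has many
representations as a sum of two elements of `A`. -/
theorem exists_sumRep_ge_of_notMem (hodd : Odd (Fintype.card G)) {A : Finset G} {g : G}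
    (hg : g ∉ restrictedSumset 3 A) :
    ∃ s, #A * #A ≤ 3 * #A + sumRep A s * (Fintype.card G - #A) := by
  by_contra! h
  set C := A.image (g - ·)
  have hcard : #C = #A := card_image_of_injective _ sub_right_injective
  have h₁ : ∑ x ∈ C, sumRep A x ≤ #C * 3 := by
    refine sum_le_card_nsmul _ _ _ fun x hx => ?_
    obtain ⟨z, hz, rfl⟩ := mem_image.1 hx
    exact sumRep_le_three hodd hz hg
  have h₂ := sum_add_sum_compl C (sumRep A)
  have h₃ : #Cᶜ = Fintype.card G - #A := by rw [card_compl, hcard]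
  rw [sum_sumRep] at h₂
  obtain ⟨s, -, hs⟩ := exists_max_image (univ : Finset G) (sumRep A) ⟨g, mem_univ g⟩
  have h₄ : ∑ x ∈ Cᶜ, sumRep A x ≤ #Cᶜ * sumRep A s :=
    sum_le_card_nsmul _ _ _ fun x _ => hs x (mem_univ x)
  have h₅ := h s
  rw [← h₃, mul_comm (sumRep A s)] at h₅
  omega

/-- In an abelian group of odd order at least `166`, every element is a sum of three distinct
elements of any given set of density more than `2/5`. -/
theorem restrictedSumset_three_eq_univ (hodd : Odd (Fintype.card G))
    (hcard : 166 ≤ Fintype.card G) {A : Finset G} (hA : 2 * Fintype.card G < 5 * #A) :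
    restrictedSumset 3 A = Set.univ := by
  refine Set.eq_univ_of_forall fun g => ?_
  by_contra hg
  obtain ⟨s, hs⟩ := exists_sumRep_ge_of_notMem hodd hg
  have hAn : #A ≤ Fintype.card G := card_le_univ A
  -- `10 = 6 + 3 + 1`: defect slack, the bound 3, strictness. At `#A = 2n/5` failure would force `n
  -- ≤ 165`.
  have hbig : Fintype.card G + 10 ≤ sumRep A s + 2 * #A := by
    by_contra! h
    have hAn' : (#A : ℤ) ≤ Fintype.card G := by exact_mod_cast hAn
    zify [hAn] at hs h hA hcard
    nlinarith [mul_le_mul_of_nonneg_right (show (sumRep A s : ℤ) ≤ Fintype.card G + 9 - 2 * #A by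
      linarith) (sub_nonneg.2 hAn'), mul_nonneg (sub_nonneg.2 hA.le) (sub_nonneg.2 hAn')]
  have hdisj : Disjoint ((A - A).image (s + ·)) (A.image (g - ·)) := by
    rw [disjoint_left]
    intro x hx hx'
    obtain ⟨d, hd, rfl⟩ := mem_image.1 hx
    obtain ⟨z, hz, hzx⟩ := mem_image.1 hx'
    have h₁ := sumRep_le_add_shiftDefect A s d
    have h₂ := shiftDefect_le_of_notMem hodd hg hd
    have h₃ := sumRep_le_three hodd hz hg
    rw [show g - z = s + d from hzx] at h₃
    omega
  have hD := card_le_univ ((A - A).image (s + ·) ∪ A.image (g - ·))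
  rw [card_union_of_disjoint hdisj, card_image_of_injective _ (add_right_injective s),
    card_image_of_injective _ sub_right_injective] at hD
  have := card_sub_eq_of_card_lt hodd hA (by omega)
  omega

end

theorem mainTheorem9 (n : ℕ) (hn : 1235 ≤ n) (hodd : Odd n) :
    (restrictedCriticalSizes (ZMod n) 3).Nonempty ∧
      (restrictedCriticalNumber (ZMod n) 3 : ℝ) ≤ 2 / 5 * (n : ℝ) + 1 := by
  have : NeZero n := ⟨by omega⟩
  have hmem : 2 * n / 5 + 1 ∈ restrictedCriticalSizes (ZMod n) 3 := by
    refine ⟨?_, fun A hA => restrictedSumset_three_eq_univ ?_ ?_ ?_⟩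
    · rw [Nat.card_zmod]
      omega
    · rwa [ZMod.card]
    · rw [ZMod.card]
      omega
    · rw [ZMod.card]
      omega
  refine ⟨⟨_, hmem⟩, ?_⟩
  have h₁ : restrictedCriticalNumber (ZMod n) 3 ≤ 2 * n / 5 + 1 := Nat.sInf_le hmem
  have h₂ : 5 * restrictedCriticalNumber (ZMod n) 3 ≤ 2 * n + 5 := by omega
  have h₃ : 5 * (restrictedCriticalNumber (ZMod n) 3 : ℝ) ≤ 2 * n + 5 := by exact_mod_cast h₂
  linarith
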